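/- Let $\Omega\subset\mathbb R^d$ be a bounded Lipschitz domain (or, more generally, any open set, in any dimension $d$), let $0<\alpha<1$, $T>0$, $\lambda\in\mathbb R$, let $\langle\cdot,\cdot\rangle$ and $\|\cdot\|$ be the inner product and norm of $L_2(\Omega)$, and let $\mathcal L$ be a linear second-order elliptic operator in weak form (or, more generally, any bounded linear operator $\mathcal L:H_0^1(\Omega)\to H^{-1}(\Omega)$) such that $\langle \mathcal L v,v\rangle\ge\lambda\|v\|^2$ for all $v\in H_0^1(\Omega)$. Denote by $$D_t^\alpha v(t)=J_t^{1-\alpha}(\partial_t v)(t)=\frac1{\Gamma(1-\alpha)}\int_0^t (t-s)^{-\alpha}\,\partial_s v(s)\,ds,\qquad t>0,$$ the Caputo derivative; for functions that may be discontinuous, or have a non-integrable derivative, at $t=0$ it is understood as $$D_t^\alpha v(t)=\frac1{\Gamma(1-\alpha)}\lim_{\varepsilon\to0^+}\Bigl[t^{-\alpha}\bigl(v(\varepsilon)-v(0)\bigr)+\int_\varepsilon^t (t-s)^{-\alpha}\,\partial_s v(s)\,ds\Bigr].$$ Let $f(\cdot,t)\in H^{-1}(\Omega)$ for $0<t\le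 T$ and $u_0\in L_2(\Omega)$. Let $u,u_h:[0,T]\to L_2(\Omega)$ both belong to $L_\infty(0,t;L_2(\Omega))\cap W^{1,\infty}(\varepsilon,t;L_2(\Omega))$ for all $0<\varepsilon<t\le T$, with $u(\cdot,t),u_h(\cdot,t)\in H_0^1(\Omega)$ for all $t\in(0,T]$. Suppose that $u$ solves $$D_t^\alpha u+\mathcal L u=f\ \text{ for } t\in(0,T],\qquad u(\cdot,0)=u_0,$$ that $u_h(\cdot,0)=u_0$, and that the residual $R_h(\cdot,t):=(D_t^\alpha+\mathcal L)u_h(\cdot,t)-f(\cdot,t)$ is in $L_2(\Omega)$ for all $t\in(0,T]$ (both equations being understood in $H^{-1}(\Omega)$). Let $\mathcal E:[0,T]\to[0,\infty)$ be a function that is absolutely continuous on $[\varepsilon,T]$ for every $0<\varepsilon\le T$ (a jump at $t=0$ is allowed) and whose Caputo derivative $D_t^\alpha\mathcal E(t)$ exists for all $t\in(0,T]$. If $$\|R_h(\cdot,t)\|\le (D_t^\alpha+\lambda)\,\mathcal E(t)\qquad\text{for all } t\in(0,T],$$ then $$\|(u_h-u)(\cdot,t)\|\le\mathcal E(t)\qquad\text{for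 all } t\in[0,T].$$ -/

import Mathlib

open Set Filter Topology MeasureTheory
open scoped InnerProductSpace ContDiff ENNReal

noncomputable section

/-! ### Fractional calculus in time, for functions with values in a Banach space -/

section Time

variable {X : Type*} [NormedAddCommGroup X] [NormedSpace ℝ X]

/-- The Riemann-Liouville fractional integral
`J_t^β v (t) = Γ(β)⁻¹ ∫_0^t (t - s)^(β - 1) v(s) ds`. -/
def fracIntegral (β : ℝ) (v : ℝ → X) (t : ℝ) : X :=
  (Real.Gamma β)⁻¹ • ∫ s in (0 : ℝ)..t, (t - s) ^ (β - 1) • v s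

/-- The integral `J_t^{1-α} (∂_t v)` at time `t`, with the part of it over the initial interval
`[0, ε]` replaced by the contribution of the increment `v(ε) - v(0)` concentrated at time `0`. -/
def caputoTrunc (α : ℝ) (v : ℝ → X) (t ε : ℝ) : X :=
  (Real.Gamma (1 - α))⁻¹ •
    (t ^ (-α) • (v ε - v 0) + ∫ s in ε..t, (t - s) ^ (-α) • deriv v s)

/-- `d` is the Caputo derivative of order `α` of `v` at the time `t > 0`, that is,
`d = J_t^{1-α} (∂_t v) (t)`.  The integral is taken as a limit of integrals over `(ε, t)`, and
`∂_t v` is the derivative of `v` on `[0, t)`, which contains the point mass `(v(0+) - v(0)) δ`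
at time `0` if `v` jumps there.  If `v` is right-continuous at `0` and the integral is
absolutely convergent, this is the usual formula, see `hasCaputoDeriv_fracIntegral`. -/
def HasCaputoDeriv (α : ℝ) (v : ℝ → X) (t : ℝ) (d : X) : Prop :=
  (∀ ε ∈ Ioo 0 t, IntervalIntegrable (fun s => (t - s) ^ (-α) • deriv v s) volume ε t) ∧
    Tendsto (caputoTrunc α v t) (𝓝[>] 0) (𝓝 d)

/-- The Caputo derivative `D_t^α v (t)` (meaningful where some `d` satisfies
`HasCaputoDeriv α v t d`). -/
def caputoDeriv (α : ℝ) (v : ℝ → X) (t : ℝ) : X :=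
  limUnder (𝓝[>] 0) (caputoTrunc α v t)

theorem HasCaputoDeriv.caputoDeriv_eq {α : ℝ} {v : ℝ → X} {t : ℝ} {d : X}
    (h : HasCaputoDeriv α v t d) : caputoDeriv α v t = d :=
  h.2.limUnder_eq

/-- Where the usual formula `D_t^α v = J_t^{1-α} (∂_t v)` makes sense, it holds. -/
theorem hasCaputoDeriv_fracIntegral {α t : ℝ} {v : ℝ → X} (ht : 0 < t)
    (hv : ContinuousWithinAt v (Ioi 0) 0)
    (hint : IntervalIntegrable (fun s => (t - s) ^ (-α) • deriv v s) volume 0 t) :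
    HasCaputoDeriv α v t (fracIntegral (1 - α) (deriv v) t) := by
  refine ⟨fun ε hε => hint.mono_set ?_, ?_⟩
  · rw [uIcc_of_le hε.2.le, uIcc_of_le ht.le]
    exact Icc_subset_Icc_left hε.1.le
  · have h1 : Tendsto (fun ε => t ^ (-α) • (v ε - v 0)) (𝓝[>] 0) (𝓝 0) := by
      have h := (Tendsto.sub_const hv (v 0)).const_smul (t ^ (-α))
      simpa using h
    have h2 : Tendsto (fun ε => ∫ s in ε..t, (t - s) ^ (-α) • deriv v s) (𝓝[>] 0)
        (𝓝 (∫ s in (0 : ℝ)..t, (t - s) ^ (-α) • deriv v s)) := by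
      have hc := intervalIntegral.continuousOn_primitive_interval_left
        (μ := volume) (a := 0) (b := t) (f := fun s => (t - s) ^ (-α) • deriv v s)
        (by rw [uIcc_of_le ht.le]
            exact (intervalIntegrable_iff_integrableOn_Icc_of_le ht.le).1 hint)
      have h0 := hc 0 left_mem_uIcc
      rw [uIcc_of_le ht.le] at h0
      refine Tendsto.mono_left h0 ?_
      rw [← nhdsWithin_Ioo_eq_nhdsGT ht]
      exact nhdsWithin_mono _ Ioo_subset_Icc_self
    have h3 := (h1.add h2).const_smul (Real.Gamma (1 - α))⁻¹
    have e : (1 - α - 1) = -α := by ring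
    rw [fracIntegral, e]
    rw [zero_add] at h3
    exact h3

/-- `v ∈ L_∞(0, t; X) ∩ W^{1,∞}(ε, t; X)` for any `0 < ε < t ≤ T`.  Membership in `W^{1,∞}` means
that `v` is the primitive of an essentially bounded function, which is then `∂_t v`. -/
structure TimeRegular (T : ℝ) (v : ℝ → X) : Prop where
  memLp : ∀ t, 0 < t → t ≤ T → MemLp v ∞ (volume.restrict (Ioo 0 t))
  memLp_deriv : ∀ ε t, 0 < ε → ε < t → t ≤ T → MemLp (deriv v) ∞ (volume.restrict (Ioo ε t))
  integral_deriv : ∀ a b, 0 < a → a ≤ b → b ≤ T → ∫ s in a..b, deriv v s = v b - v a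

end Time

/-! ### The spaces `L₂(Ω)`, `H₀¹(Ω)` and `H⁻¹(Ω)` for `Ω ⊆ ℝᵈ` -/

section Space

variable {d : ℕ}

/-- The real Hilbert space `L₂(Ω)`. -/
abbrev L2 (Ω : Set (EuclideanSpace ℝ (Fin d))) : Type :=
  Lp ℝ 2 ((volume : Measure (EuclideanSpace ℝ (Fin d))).restrict Ω)

/-- The Hilbert space `L₂(Ω) × L₂(Ω)ᵈ` of pairs `(v, g)`, with the norm
`(‖v‖² + ∑ i, ‖g i‖²)^{1/2}`, which for `g = ∇ v` is the norm of `H¹(Ω)`. -/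
abbrev L2Pair (Ω : Set (EuclideanSpace ℝ (Fin d))) : Type :=
  WithLp 2 (L2 Ω × PiLp 2 (fun _ : Fin d => L2 Ω))

/-- The pairs `(φ, ∇ φ)` with `φ ∈ C_c^∞(Ω)`. -/
def testPairs (Ω : Set (EuclideanSpace ℝ (Fin d))) : Submodule ℝ (L2Pair Ω) where
  carrier := {w | ∃ φ : EuclideanSpace ℝ (Fin d) → ℝ,
    ContDiff ℝ ∞ φ ∧ HasCompactSupport φ ∧ tsupport φ ⊆ Ω ∧
    w.fst =ᵐ[volume.restrict Ω] φ ∧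
    ∀ i, w.snd i =ᵐ[volume.restrict Ω] fun x => fderiv ℝ φ x (EuclideanSpace.single i 1)}
  zero_mem' := by
    refine ⟨0, contDiff_const, HasCompactSupport.zero, by simp, Lp.coeFn_zero _ _ _,
      fun i => ?_⟩
    filter_upwards [Lp.coeFn_zero ℝ 2 ((volume : Measure (EuclideanSpace ℝ (Fin d))).restrict Ω)]
      with x hx
    simpa using hx
  add_mem' := by
    rintro w w' ⟨φ, h1, h2, h3, h4, h5⟩ ⟨ψ, k1, k2, k3, k4, k5⟩
    refine ⟨φ + ψ, h1.add k1, h2.add k2,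
      (tsupport_add φ ψ).trans (union_subset h3 k3), ?_, fun i => ?_⟩
    · filter_upwards [Lp.coeFn_add w.fst w'.fst, h4, k4] with x e e1 e2
      exact e.trans (congrArg₂ (· + ·) e1 e2)
    · filter_upwards [Lp.coeFn_add (w.snd i) (w'.snd i), h5 i, k5 i] with x e e1 e2
      have hd := fderiv_add (h1.differentiable (by simp) x) (k1.differentiable (by simp) x)
      rw [hd]
      exact e.trans (congrArg₂ (· + ·) e1 e2)
  smul_mem' := by
    rintro c w ⟨φ, h1, h2, h3, h4, h5⟩
    refine ⟨c • φ, h1.const_smul c, h2.smul_left (f := fun _ => c),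
      (tsupport_smul_subset_right (fun _ => c) φ).trans h3, ?_, fun i => ?_⟩
    · filter_upwards [Lp.coeFn_smul c w.fst, h4] with x e e1
      simp [e, e1]
    · filter_upwards [Lp.coeFn_smul c (w.snd i), h5 i] with x e e1
      have hd := fderiv_const_smul (h1.differentiable (by simp) x) c
      simp [hd, e, e1]

/-- The Hilbert space `H₀¹(Ω)`, the closure of `C_c^∞(Ω)` in the norm of `H¹(Ω)`; its elements
are stored as pairs `(v, ∇ v)`. -/
abbrev H01 (Ω : Set (EuclideanSpace ℝ (Fin d))) : Type :=
  (testPairs Ω).topologicalClosure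

/-- The space `H⁻¹(Ω)`, the dual of `H₀¹(Ω)`. -/
abbrev Hneg1 (Ω : Set (EuclideanSpace ℝ (Fin d))) : Type :=
  H01 Ω →L[ℝ] ℝ

/-- The embedding `H₀¹(Ω) → L₂(Ω)`, `(v, ∇ v) ↦ v`. -/
def H01.toL2 (Ω : Set (EuclideanSpace ℝ (Fin d))) : H01 Ω →L[ℝ] L2 Ω :=
  (WithLp.fstL 2 ℝ (L2 Ω) (PiLp 2 (fun _ : Fin d => L2 Ω))).comp
    (testPairs Ω).topologicalClosure.subtypeL

/-- The embedding `L₂(Ω) → H⁻¹(Ω)`, `w ↦ ⟨w, ·⟩`. -/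
def L2.toHneg1 {Ω : Set (EuclideanSpace ℝ (Fin d))} (w : L2 Ω) : Hneg1 Ω :=
  (innerSL ℝ w).comp (H01.toL2 Ω)

/-- `R` is the residual `(D_t^α + 𝓛) w - f` of `w` on `(0, T]`: for every such `t`, the function
`w(·, t)` is in `H₀¹(Ω)` and the residual `R(·, t)` is in `L₂(Ω)` (in particular, `w(·, t) = 0` on
`∂Ω`); the equation holds in `H⁻¹(Ω)`. -/
def IsResidual {Ω : Set (EuclideanSpace ℝ (Fin d))} (α T : ℝ) (L : H01 Ω →L[ℝ] Hneg1 Ω)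
    (f : ℝ → Hneg1 Ω) (w R : ℝ → L2 Ω) : Prop :=
  ∀ t ∈ Ioc 0 T, ∃ W : H01 Ω, H01.toL2 Ω W = w t ∧
    L2.toHneg1 (R t) = L2.toHneg1 (caputoDeriv α w t) + L W - f t

/-- `u` solves `D_t^α u + 𝓛 u = f` in `Ω × (0, T]`, `u = 0` on `∂Ω`, `u(·, 0) = u₀`. -/
def IsSolution {Ω : Set (EuclideanSpace ℝ (Fin d))} (α T : ℝ) (L : H01 Ω →L[ℝ] Hneg1 Ω)
    (f : ℝ → Hneg1 Ω) (u₀ : L2 Ω) (u : ℝ → L2 Ω) : Prop :=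
  u 0 = u₀ ∧ ∀ t ∈ Ioc 0 T, ∃ U : H01 Ω, H01.toL2 Ω U = u t ∧
    L2.toHneg1 (caputoDeriv α u t) + L U = f t

end Space

end

/-! The proof is a maximum principle with a barrier. The difference `w - u` is bounded on `(0, T]`
but may jump at time `0`, so the excess `‖w - u‖ - E`, if positive somewhere, need not attain a
maximum. Dividing it by a positive `B` with `B(0+) = ∞` (`exists_caputo_barrier`) forces an attained
maximum `δ > 0` at some `t > 0` (`exists_touching_multiple`).

The norm is never differentiated. With `l` the inner product with the unit vector along `(w -
u)(t)`, the scalar function `z = E + δ B - l (w - u)` is nonnegative on `(0, T]` and vanishes at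
`t`. Integration by parts shows that its truncated Caputo derivative at `t` is nonpositive
(`integral_sub_rpow_neg_mul_le_of_nonneg`, `caputoTrunc_le_of_touching`). Testing the equations with
`w - u` bounds the Caputo derivative of `l (w - u)` at `t` by `D_t^α E - lam * δ B`, so that of `E -
l (w - u)` is at least `lam * δ B`. Hence `(D_t^α + lam) B ≤ 0` at `t`, although `B` is a strict
supersolution. As `‖w - u‖ - E = δ B` exactly at `t`, the sign of `lam` is irrelevant. -/

/-! ### Integration by parts against the kernel `(t - s)^(-α)`. -/

section Kernel

variable {α t a b : ℝ}

theorem hasDerivAt_sub_rpow_neg {s : ℝ} (hs : s < t) :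
    HasDerivAt (fun s => (t - s) ^ (-α)) (α * (t - s) ^ (-α - 1)) s := by
  have h := ((hasDerivAt_id' s).const_sub t).rpow_const (p := -α) (Or.inl (by linarith))
  convert h using 1
  ring

theorem contDiffOn_sub_rpow_neg (hb : b < t) :
    ContDiffOn ℝ 1 (fun s => (t - s) ^ (-α)) (Iic b) :=
  (contDiffOn_const.sub contDiffOn_id).rpow_const_of_ne fun s hs => by
    exact (sub_pos.2 (lt_of_le_of_lt (mem_Iic.1 hs) hb)).ne'

theorem sub_rpow_neg_le (hα : 0 ≤ α) (hab : a ≤ b) (hb : b < t) :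
    (t - a) ^ (-α) ≤ (t - b) ^ (-α) :=
  Real.rpow_le_rpow_of_nonpos (by linarith) (by linarith) (by linarith)

theorem intervalIntegrable_sub_rpow_neg (hα : α < 1) :
    IntervalIntegrable (fun s => (t - s) ^ (-α)) volume a b := by
  have h := (intervalIntegral.intervalIntegrable_rpow' (r := -α) (a := t - a) (b := t - b)
    (by linarith)).comp_sub_left t
  simpa using h

theorem continuousOn_mul_sub_rpow_neg_sub_one (hab : a ≤ b) (hb : b < t) :
    ContinuousOn (fun s => α * (t - s) ^ (-α - 1)) (uIcc a b) := by
  rw [uIcc_of_le hab]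
  refine continuousOn_const.mul ((continuousOn_const.sub continuousOn_id).rpow_const ?_)
  intro s hs
  exact Or.inl (sub_pos.2 (hs.2.trans_lt hb)).ne'

theorem integral_mul_sub_rpow_neg_sub_one (hab : a ≤ b) (hb : b < t) :
    ∫ s in a..b, α * (t - s) ^ (-α - 1) = (t - b) ^ (-α) - (t - a) ^ (-α) := by
  refine intervalIntegral.integral_eq_sub_of_hasDerivAt (f := fun s => (t - s) ^ (-α)) ?_
    (continuousOn_mul_sub_rpow_neg_sub_one hab hb).intervalIntegrable
  intro s hs
  rw [uIcc_of_le hab] at hs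
  exact hasDerivAt_sub_rpow_neg (hs.2.trans_lt hb)

variable {z q : ℝ → ℝ}

/-- Integration by parts against the kernel of the Caputo derivative, for a function `z` which
is the primitive of an integrable function `q`. -/
theorem integral_sub_rpow_neg_mul (hab : a ≤ b) (hb : b < t)
    (hq : IntervalIntegrable q volume a b)
    (hz : ∀ x ∈ Icc a b, ∫ s in a..x, q s = z x - z a) :
    ∫ s in a..b, (t - s) ^ (-α) * q s
      = (t - b) ^ (-α) * z b - (t - a) ^ (-α) * z a
        - ∫ s in a..b, α * (t - s) ^ (-α - 1) * z s := by
  have hk : AbsolutelyContinuousOnInterval (fun s => (t - s) ^ (-α)) a b := by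
    refine ContDiffOn.absolutelyContinuousOnInterval ((contDiffOn_sub_rpow_neg hb).mono ?_)
    rw [uIcc_of_le hab]
    exact Icc_subset_Iic_self
  -- The explicit primitive of `q` stands in for `z`: the two agree on `[a, b]`, and its derivative
  -- is `q` almost everywhere.
  have hw : AbsolutelyContinuousOnInterval (fun x => (∫ s in a..x, q s) + z a) a b :=
    (hq.absolutelyContinuousOnInterval_intervalIntegral left_mem_uIcc).fun_add
      (LipschitzWith.const (z a)).lipschitzOnWith.absolutelyContinuousOnInterval
  have h := hk.integral_mul_deriv_eq_deriv_mul hw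
  have e1 : ∫ s in a..b, (t - s) ^ (-α) * q s
      = ∫ s in a..b, (t - s) ^ (-α) * deriv (fun x => (∫ s in a..x, q s) + z a) s := by
    refine intervalIntegral.integral_congr_ae ?_
    filter_upwards [hq.ae_hasDerivAt_integral] with x hx hxm
    rw [((hx (uIoc_subset_uIcc hxm) a left_mem_uIcc).add_const (z a)).deriv]
  have e2 : ∫ s in a..b, deriv (fun s => (t - s) ^ (-α)) s * ((∫ r in a..s, q r) + z a)
      = ∫ s in a..b, α * (t - s) ^ (-α - 1) * z s := by
    refine intervalIntegral.integral_congr fun x hx => ?_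
    rw [uIcc_of_le hab] at hx
    rw [(hasDerivAt_sub_rpow_neg (hx.2.trans_lt hb)).deriv, hz x hx]
    ring
  rw [e1, h, e2, hz b (right_mem_Icc.2 hab)]
  simp

/-- The variation over `[a, b]` of the truncated Caputo derivative is controlled by the supremum
of the function on this interval. -/
theorem abs_caputo_increment_le (hα : 0 < α) (ha : 0 < a) (hab : a ≤ b) (hb : b < t)
    (hq : IntervalIntegrable q volume a b)
    (hz : ∀ x ∈ Icc a b, ∫ s in a..x, q s = z x - z a) {M : ℝ}
    (hM : ∀ x ∈ Icc a b, |z x| ≤ M) :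
    |t ^ (-α) * (z a - z b) + ∫ s in a..b, (t - s) ^ (-α) * q s|
      ≤ 2 * M * ((t - b) ^ (-α) - t ^ (-α)) := by
  have hka : t ^ (-α) ≤ (t - a) ^ (-α) := by
    simpa using sub_rpow_neg_le (t := t) hα.le ha.le (hab.trans_lt hb)
  have hkb : (t - a) ^ (-α) ≤ (t - b) ^ (-α) := sub_rpow_neg_le hα.le hab hb
  have hint : |∫ s in a..b, α * (t - s) ^ (-α - 1) * z s|
      ≤ M * ((t - b) ^ (-α) - (t - a) ^ (-α)) := by
    rw [← integral_mul_sub_rpow_neg_sub_one hab hb, ← intervalIntegral.integral_const_mul,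
      ← Real.norm_eq_abs]
    refine intervalIntegral.norm_integral_le_of_norm_le hab ?_
      ((continuousOn_mul_sub_rpow_neg_sub_one hab hb).intervalIntegrable.const_mul M)
    refine Eventually.of_forall fun s hs => ?_
    have hp : 0 ≤ α * (t - s) ^ (-α - 1) :=
      mul_nonneg hα.le (Real.rpow_nonneg (by linarith [hs.2]) _)
    rw [norm_mul, Real.norm_of_nonneg hp, mul_comm]
    exact mul_le_mul_of_nonneg_right (hM s (Ioc_subset_Icc_self hs)) hp
  have h1 := hM a (left_mem_Icc.2 hab)
  have h2 := hM b (right_mem_Icc.2 hab)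
  -- With `k(s) = (t - s)^(-α)`, which increases, the boundary terms contribute at most `M (k(a) -
  -- k(0))` and `M (k(b) - k(0))`, and the integral `M (k(b) - k(a))`; these add up to the bound.
  rw [integral_sub_rpow_neg_mul hab hb hq hz]
  rw [abs_le] at hint h1 h2 ⊢
  constructor <;> nlinarith

/-- At a point where a nonnegative function vanishes, its Caputo derivative is nonpositive. -/
theorem integral_sub_rpow_neg_mul_le_of_nonneg (hα : 0 < α) (hat : a < t)
    (hq : IntervalIntegrable q volume a t)
    (hkq : IntervalIntegrable (fun s => (t - s) ^ (-α) * q s) volume a t)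
    (hz : ∀ x ∈ Icc a t, ∫ s in a..x, q s = z x - z a)
    (hz0 : ∀ x ∈ Icc a t, 0 ≤ z x) (hzt : z t = 0) :
    ∫ s in a..t, (t - s) ^ (-α) * q s ≤ -((t - a) ^ (-α) * z a) := by
  have hsub : ∀ r ∈ Ioo a t, ∀ {g : ℝ → ℝ}, IntervalIntegrable g volume a t →
      IntervalIntegrable g volume a r ∧ IntervalIntegrable g volume r t := fun r hr g hg =>
    ⟨hg.mono_set (by
        rw [uIcc_of_le hr.1.le, uIcc_of_le hat.le]; exact Icc_subset_Icc_right hr.2.le),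
      hg.mono_set (by
        rw [uIcc_of_le hr.2.le, uIcc_of_le hat.le]; exact Icc_subset_Icc_left hr.1.le)⟩
  -- Parts are taken only up to `r < t`, away from the singularity. Since `z t = 0`, the boundary
  -- term at `r` is at most the integral of `|k q|` over `(r, t)`, where `k` is the kernel, and this
  -- tends to `0` as `r → t`.
  have key : ∀ r ∈ Ioo a t, ∫ s in a..r, (t - s) ^ (-α) * q s
      ≤ (∫ s in r..t, |(t - s) ^ (-α) * q s|) - (t - a) ^ (-α) * z a := by
    intro r hr
    have h1 := integral_sub_rpow_neg_mul (α := α) hr.1.le hr.2 (hsub r hr hq).1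
      fun x hx => hz x ⟨hx.1, hx.2.trans hr.2.le⟩
    have h2 : 0 ≤ ∫ s in a..r, α * (t - s) ^ (-α - 1) * z s :=
      intervalIntegral.integral_nonneg hr.1.le fun s hs =>
        mul_nonneg (mul_nonneg hα.le (Real.rpow_nonneg (by linarith [hs.2, hr.2]) _))
          (hz0 s ⟨hs.1, hs.2.trans hr.2.le⟩)
    have h3 : z r = -∫ s in r..t, q s := by
      have e := intervalIntegral.integral_add_adjacent_intervals (hsub r hr hq).1 (hsub r hr hq).2
      rw [hz r ⟨hr.1.le, hr.2.le⟩, hz t (right_mem_Icc.2 hat.le), hzt] at e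
      linarith
    have h4 : (t - r) ^ (-α) * z r ≤ ∫ s in r..t, |(t - s) ^ (-α) * q s| := by
      rw [h3, ← intervalIntegral.integral_neg, ← intervalIntegral.integral_const_mul]
      refine intervalIntegral.integral_mono_on_of_le_Ioo hr.2.le
        ((hsub r hr hq).2.neg.const_mul _) (hsub r hr hkq).2.abs fun s hs => ?_
      have hp : 0 ≤ (t - r) ^ (-α) := Real.rpow_nonneg (by linarith [hr.2]) _
      have hk : (t - r) ^ (-α) ≤ (t - s) ^ (-α) := sub_rpow_neg_le hα.le hs.1.le hs.2
      rw [abs_mul, abs_of_nonneg (hp.trans hk)]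
      exact (mul_le_mul_of_nonneg_left (neg_le_abs _) hp).trans
        (mul_le_mul_of_nonneg_right hk (abs_nonneg _))
    linarith
  have l1 : Tendsto (fun r => ∫ s in a..r, (t - s) ^ (-α) * q s) (𝓝[<] t)
      (𝓝 (∫ s in a..t, (t - s) ^ (-α) * q s)) := by
    have h := intervalIntegral.continuousOn_primitive_interval' hkq left_mem_uIcc t right_mem_uIcc
    refine h.mono_left ?_
    rw [← nhdsWithin_Ioo_eq_nhdsLT hat, uIcc_of_le hat.le]
    exact nhdsWithin_mono _ Ioo_subset_Icc_self
  have l2 : Tendsto (fun r => ∫ s in r..t, |(t - s) ^ (-α) * q s|) (𝓝[<] t) (𝓝 0) := by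
    have h := intervalIntegral.continuousOn_primitive_interval' hkq.abs right_mem_uIcc t
      right_mem_uIcc
    have h' : Tendsto (fun r => ∫ s in t..r, |(t - s) ^ (-α) * q s|) (𝓝[<] t) (𝓝 0) := by
      have h2 := h.mono_left (y := 𝓝[<] t) (by
        rw [← nhdsWithin_Ioo_eq_nhdsLT hat, uIcc_of_le hat.le]
        exact nhdsWithin_mono _ Ioo_subset_Icc_self)
      simpa using h2
    simpa [intervalIntegral.integral_symm t] using h'.neg
  have l3 := l2.sub_const ((t - a) ^ (-α) * z a)
  rw [zero_sub] at l3
  refine le_of_tendsto_of_tendsto l1 l3 ?_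
  filter_upwards [Ioo_mem_nhdsLT hat] with r hr using key r hr

end Kernel

/-! ### Construction of the barrier. -/

section Barrier

variable {α t : ℝ}

theorem integral_sub_rpow_neg {ε : ℝ} (hα : α < 1) :
    ∫ s in ε..t, (t - s) ^ (-α) = (t - ε) ^ (1 - α) / (1 - α) := by
  have h := intervalIntegral.integral_comp_sub_left (fun s : ℝ => s ^ (-α)) t (a := ε) (b := t)
  rw [h, integral_rpow (Or.inl (by linarith)), sub_self, Real.zero_rpow (by linarith)]
  rw [sub_zero, neg_add_eq_sub]

/-- Lower bound for the Caputo derivative of `s ↦ -log s`. -/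
theorem le_caputo_neg_log {ε : ℝ} (hα : α ∈ Ioo (0 : ℝ) 1) (hε : 0 < ε) (hεt : ε < t) :
    t ^ (-α) * (-Real.log t - 1 / (1 - α))
      ≤ t ^ (-α) * (-Real.log ε) - ∫ s in ε..t, (t - s) ^ (-α) * s⁻¹ := by
  have ht : 0 < t := hε.trans hεt
  have hk : IntervalIntegrable (fun s => (t - s) ^ (-α)) volume ε t :=
    intervalIntegrable_sub_rpow_neg hα.2
  have hinv : ContinuousOn (fun s : ℝ => s⁻¹) (uIcc ε t) := by
    rw [uIcc_of_le hεt.le]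
    exact continuousOn_id.inv₀ fun s hs => (hε.trans_le hs.1).ne'
  -- The majorant minus the integrand is `(t^(1-α) - (t-s)^(1-α)) / (s t) ≥ 0`; it separates the
  -- singularities at `0` and `t`.
  have h1 : ∫ s in ε..t, (t - s) ^ (-α) * s⁻¹
      ≤ ∫ s in ε..t, (t ^ (-α) * s⁻¹ + t⁻¹ * (t - s) ^ (-α)) := by
    refine intervalIntegral.integral_mono_on_of_le_Ioo hεt.le (hk.mul_continuousOn hinv)
      ((hinv.intervalIntegrable.const_mul _).add (hk.const_mul _)) fun s hs => ?_
    have hs0 : 0 < s := hε.trans hs.1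
    have hts : 0 < t - s := by linarith [hs.2]
    have h2 : (t - s) ^ (-α) * (t - s) ≤ t ^ (-α) * t := by
      rw [← Real.rpow_add_one hts.ne', ← Real.rpow_add_one ht.ne']
      exact Real.rpow_le_rpow hts.le (by linarith) (by linarith [hα.2])
    have e : t ^ (-α) * s⁻¹ + t⁻¹ * (t - s) ^ (-α) - (t - s) ^ (-α) * s⁻¹
        = (t ^ (-α) * t - (t - s) ^ (-α) * (t - s)) / (s * t) := by
      field_simp
      ring
    have h3 : 0 ≤ (t ^ (-α) * t - (t - s) ^ (-α) * (t - s)) / (s * t) :=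
      div_nonneg (by linarith) (by positivity)
    linarith
  rw [intervalIntegral.integral_add (hinv.intervalIntegrable.const_mul _) (hk.const_mul _),
    intervalIntegral.integral_const_mul, intervalIntegral.integral_const_mul,
    integral_inv_of_pos hε ht, integral_sub_rpow_neg hα.2, Real.log_div ht.ne' hε.ne'] at h1
  have h2 : t⁻¹ * ((t - ε) ^ (1 - α) / (1 - α)) ≤ t ^ (-α) * (1 / (1 - α)) := by
    have h3 : (t - ε) ^ (1 - α) ≤ t * t ^ (-α) := by
      rw [mul_comm, ← Real.rpow_add_one ht.ne', neg_add_eq_sub]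
      exact Real.rpow_le_rpow (by linarith) (by linarith) (by linarith [hα.2])
    have h4 : 0 < 1 - α := by linarith [hα.2]
    rw [← mul_div_assoc, mul_one_div]
    refine div_le_div_of_nonneg_right ?_ h4.le
    rw [inv_mul_le_iff₀ ht]
    exact h3
  linarith

/-- Lower bound for the Caputo derivative of the exponential with a jump from `0` at time `0`. -/
theorem eventually_le_caputo_exp {h : ℝ} (hα : 0 < α) (hα1 : α < 1) (hh : 0 < h) (ht : 0 < t) :
    ∀ᶠ ε in 𝓝[>] 0, Real.exp (h⁻¹ * t) * (t ^ (-α) / 2 + h ^ (-α) / 4)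
      ≤ t ^ (-α) * Real.exp (h⁻¹ * ε)
        + ∫ s in ε..t, (t - s) ^ (-α) * (h⁻¹ * Real.exp (h⁻¹ * s)) := by
  have hcont : Continuous fun s : ℝ => h⁻¹ * Real.exp (h⁻¹ * s) := by fun_prop
  have hexp : ∀ a b : ℝ, ∫ s in a..b, h⁻¹ * Real.exp (h⁻¹ * s)
      = Real.exp (h⁻¹ * b) - Real.exp (h⁻¹ * a) := fun a b => by
    refine intervalIntegral.integral_eq_sub_of_hasDerivAt
      (f := fun s => Real.exp (h⁻¹ * s)) (fun s _ => ?_) (hcont.intervalIntegrable _ _)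
    simpa [mul_comm] using ((hasDerivAt_id' s).const_mul h⁻¹).exp
  have hint : ∀ a b : ℝ, IntervalIntegrable
      (fun s => (t - s) ^ (-α) * (h⁻¹ * Real.exp (h⁻¹ * s))) volume a b := fun a b =>
    (intervalIntegrable_sub_rpow_neg hα1).mul_continuousOn hcont.continuousOn
  have hlow : ∀ a b, a ≤ b → b ≤ t → (t - a) ^ (-α) * (Real.exp (h⁻¹ * b) - Real.exp (h⁻¹ * a))
      ≤ ∫ s in a..b, (t - s) ^ (-α) * (h⁻¹ * Real.exp (h⁻¹ * s)) := by
    intro a b hab hbt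
    rw [← hexp, ← intervalIntegral.integral_const_mul]
    refine intervalIntegral.integral_mono_on_of_le_Ioo hab
      ((hcont.intervalIntegrable _ _).const_mul _) (hint a b) fun s hs => ?_
    exact mul_le_mul_of_nonneg_right (sub_rpow_neg_le hα.le hs.1.le (hs.2.trans_le hbt))
      (by positivity)
  have hsplit : ∀ ε ∈ Ioo 0 t, t ^ (-α) * Real.exp (h⁻¹ * t) ≤ t ^ (-α) * Real.exp (h⁻¹ * ε)
      + ∫ s in ε..t, (t - s) ^ (-α) * (h⁻¹ * Real.exp (h⁻¹ * s)) := by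
    intro ε hε
    have h1 := hlow ε t hε.2.le le_rfl
    have h2 : t ^ (-α) ≤ (t - ε) ^ (-α) := by
      simpa using sub_rpow_neg_le (t := t) hα.le hε.1.le hε.2
    have h3 : Real.exp (h⁻¹ * ε) ≤ Real.exp (h⁻¹ * t) := by
      gcongr
      exact hε.2.le
    nlinarith
  -- For `t ≤ h` the bound `t^(-α) * exp(t/h)` suffices, because `h^(-α) ≤ t^(-α)`. For `t > h` the
  -- interval `[t - h, t]` alone yields `h^(-α) * exp(t/h) / 2`, and the claim is the mean of the
  -- two bounds.
  rcases le_or_gt t h with hth | hth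
  · filter_upwards [Ioo_mem_nhdsGT ht] with ε hε
    have h1 : h ^ (-α) ≤ t ^ (-α) := Real.rpow_le_rpow_of_nonpos ht hth (by linarith)
    have h2 : 0 < h ^ (-α) := Real.rpow_pos_of_pos hh _
    refine le_trans ?_ (hsplit ε hε)
    rw [mul_comm (t ^ (-α))]
    exact mul_le_mul_of_nonneg_left (by linarith) (Real.exp_pos _).le
  · filter_upwards [Ioo_mem_nhdsGT (sub_pos.2 hth)] with ε hε
    have h0 := hsplit ε ⟨hε.1, by linarith [hε.2]⟩
    have h1 := hlow (t - h) t (by linarith) le_rfl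
    have h2 := intervalIntegral.integral_add_adjacent_intervals (hint ε (t - h)) (hint (t - h) t)
    have h3 : 0 ≤ ∫ s in ε..(t - h), (t - s) ^ (-α) * (h⁻¹ * Real.exp (h⁻¹ * s)) :=
      intervalIntegral.integral_nonneg hε.2.le fun s hs => mul_nonneg
        (Real.rpow_nonneg (by linarith [hs.2]) _) (by positivity)
    have h4 : 0 ≤ t ^ (-α) * Real.exp (h⁻¹ * ε) := by positivity
    have h5 : Real.exp (h⁻¹ * (t - h)) ≤ Real.exp (h⁻¹ * t) / 2 := by
      have e : h⁻¹ * t = h⁻¹ * (t - h) + 1 := by field_simp; ring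
      have e1 := Real.add_one_le_exp 1
      rw [e, Real.exp_add]
      nlinarith [Real.exp_pos (h⁻¹ * (t - h))]
    have h6 : 0 < h ^ (-α) := Real.rpow_pos_of_pos hh _
    rw [sub_sub_cancel] at h1
    nlinarith

/-- A positive function that blows up at time `0` and is a strict supersolution of
`D_t^α v + lam v = 0`, where `v` is understood to vanish at time `0`. -/
theorem exists_caputo_barrier {T : ℝ} (lam : ℝ) (hα : α ∈ Ioo (0 : ℝ) 1) (hT : 0 < T) :
    ∃ B B' : ℝ → ℝ, (∀ s, 0 < s → HasDerivAt B (B' s) s) ∧ ContinuousOn B' (Ioi 0) ∧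
      (∀ s ∈ Ioc 0 T, 0 < B s) ∧ Tendsto B (𝓝[>] 0) atTop ∧
      ∀ t ∈ Ioc 0 T, ∃ c > 0, ∀ᶠ ε in 𝓝[>] 0,
        c ≤ t ^ (-α) * B ε + (∫ s in ε..t, (t - s) ^ (-α) * B' s)
          + Real.Gamma (1 - α) * lam * B t := by
  set G := Real.Gamma (1 - α) * |lam| with hG
  have hΓ : 0 < Real.Gamma (1 - α) := Real.Gamma_pos_of_pos (by linarith [hα.2])
  have hG0 : 0 ≤ G := mul_nonneg hΓ.le (abs_nonneg _)
  have hC : 0 < 1 / (1 - α) := one_div_pos.2 (by linarith [hα.2])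
  -- Chosen so that `h^(-α) / 4 ≥ G`: the exponential then absorbs its own `lam` term, for either
  -- sign of `lam`.
  set h := (4 * G + 1) ^ (-(1 / α)) with hh
  have hh0 : 0 < h := Real.rpow_pos_of_pos (by linarith) _
  have hhα : h ^ (-α) = 4 * G + 1 := by
    rw [hh, ← Real.rpow_mul (by linarith)]
    have : -(1 / α) * -α = 1 := by field_simp [hα.1.ne']
    rw [this, Real.rpow_one]
  have hTα : 0 ≤ G * (T ^ α / α) := mul_nonneg hG0 (div_nonneg (by positivity) hα.1.le)
  -- The jump of `A exp(s/h)` supplies `A t^(-α) / 2`, which pays for the defect of `-log`, for the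
  -- `lam` term of `log (T/t)`, and for the strict margin `c = t^(-α)`.
  set A := 2 * (1 / (1 - α) + G * (T ^ α / α) + 1) with hA
  have hA0 : 0 < A := by positivity
  refine ⟨fun s => A * Real.exp (h⁻¹ * s) + (Real.log T - Real.log s),
    fun s => A * (h⁻¹ * Real.exp (h⁻¹ * s)) - s⁻¹, fun s hs => ?_, ?_, fun s hs => ?_, ?_, ?_⟩
  · have h1 := (((hasDerivAt_id' s).const_mul h⁻¹).exp.const_mul A).add
      ((Real.hasDerivAt_log hs.ne').const_sub (Real.log T))
    exact h1.congr_deriv (by ring)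
  · exact Continuous.continuousOn (by fun_prop) |>.sub
      (continuousOn_id.inv₀ fun s hs => (mem_Ioi.1 hs).ne')
  · have := Real.log_le_log hs.1 hs.2
    have : 0 < A * Real.exp (h⁻¹ * s) := by positivity
    linarith
  · refine tendsto_atTop_mono (f := fun s => Real.log T - Real.log s) (fun s => ?_) ?_
    · have : 0 < A * Real.exp (h⁻¹ * s) := by positivity
      linarith
    · simp only [sub_eq_add_neg]
      exact tendsto_atTop_add_const_left _ _
        (tendsto_neg_atBot_atTop.comp Real.tendsto_log_nhdsGT_zero)
  · intro t ht
    have htα : 0 < t ^ (-α) := Real.rpow_pos_of_pos ht.1 _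
    refine ⟨t ^ (-α), htα, ?_⟩
    filter_upwards [eventually_le_caputo_exp hα.1 hα.2 hh0 ht.1, Ioo_mem_nhdsGT ht.1] with ε hε hεt
    have hlog := le_caputo_neg_log hα hεt.1 hεt.2
    have hcont : Continuous fun s : ℝ => h⁻¹ * Real.exp (h⁻¹ * s) := by fun_prop
    have hk : IntervalIntegrable (fun s => (t - s) ^ (-α)) volume ε t :=
      intervalIntegrable_sub_rpow_neg hα.2
    have hinv : ContinuousOn (fun s : ℝ => s⁻¹) (uIcc ε t) := by
      rw [uIcc_of_le hεt.2.le]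
      exact continuousOn_id.inv₀ fun s hs => (hεt.1.trans_le hs.1).ne'
    have e : ∫ s in ε..t, (t - s) ^ (-α) * (A * (h⁻¹ * Real.exp (h⁻¹ * s)) - s⁻¹)
        = A * (∫ s in ε..t, (t - s) ^ (-α) * (h⁻¹ * Real.exp (h⁻¹ * s)))
          - ∫ s in ε..t, (t - s) ^ (-α) * s⁻¹ := by
      rw [← intervalIntegral.integral_const_mul, ← intervalIntegral.integral_sub
        ((hk.mul_continuousOn hcont.continuousOn).const_mul A) (hk.mul_continuousOn hinv)]
      exact intervalIntegral.integral_congr fun s _ => by ring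
    have hlogT : 0 ≤ Real.log T - Real.log t := by linarith [Real.log_le_log ht.1 ht.2]
    have hlogT' : Real.log T - Real.log t ≤ t ^ (-α) * (T ^ α / α) := by
      rw [← Real.log_div hT.ne' ht.1.ne']
      refine (Real.log_le_rpow_div (div_pos hT ht.1).le hα.1).trans_eq ?_
      rw [Real.div_rpow hT.le ht.1.le, Real.rpow_neg ht.1.le]
      ring
    rw [hhα] at hε
    have hlam : -G ≤ Real.Gamma (1 - α) * lam := by
      rw [hG, ← mul_neg]
      exact mul_le_mul_of_nonneg_left (neg_abs_le lam) hΓ.le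
    have hX : 1 ≤ Real.exp (h⁻¹ * t) :=
      Real.one_le_exp (mul_nonneg (inv_nonneg.2 hh0.le) ht.1.le)
    rw [e]
    generalize Real.exp (h⁻¹ * t) = X at *
    generalize Real.exp (h⁻¹ * ε) = Y at *
    have hB : 0 ≤ A * X + (Real.log T - Real.log t) := by positivity
    have h1 : -G * (A * X + (Real.log T - Real.log t))
        ≤ Real.Gamma (1 - α) * lam * (A * X + (Real.log T - Real.log t)) :=
      mul_le_mul_of_nonneg_right hlam hB
    have h2 := mul_le_mul_of_nonneg_left hε hA0.le
    have h3 : A * t ^ (-α) / 2 ≤ A * (X * (t ^ (-α) / 2)) := by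
      have : t ^ (-α) ≤ X * t ^ (-α) := le_mul_of_one_le_left htα.le hX
      nlinarith
    have h4 : G * (Real.log T - Real.log t) ≤ t ^ (-α) * (G * (T ^ α / α)) := by
      have := mul_le_mul_of_nonneg_left hlogT' hG0
      linarith
    have h5 : A * t ^ (-α) / 2
        = t ^ (-α) * (1 / (1 - α)) + t ^ (-α) * (G * (T ^ α / α)) + t ^ (-α) := by
      rw [hA]; ring
    have h6 : 0 ≤ t ^ (-α) * (Real.log T - Real.log t) := mul_nonneg htα.le hlogT
    have h7 : 0 ≤ A * X := by positivity
    linarith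

end Barrier

/-! ### Pointwise bounds and existence of the Caputo derivative. -/

section TimeRegular

variable {X : Type*} [NormedAddCommGroup X] [NormedSpace ℝ X] {T : ℝ} {v : ℝ → X}

namespace TimeRegular

theorem memLp_deriv_restrict_Ioc (hv : TimeRegular T v) {a b : ℝ} (ha : 0 < a) (hab : a ≤ b)
    (hb : b ≤ T) : MemLp (deriv v) ∞ (volume.restrict (Ioc a b)) := by
  rcases hab.eq_or_lt with rfl | hab
  · simp
  · rw [← restrict_Ioo_eq_restrict_Ioc]
    exact hv.memLp_deriv a b ha hab hb

theorem intervalIntegrable_deriv (hv : TimeRegular T v) {a b : ℝ} (ha : 0 < a) (hab : a ≤ b)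
    (hb : b ≤ T) : IntervalIntegrable (deriv v) volume a b := by
  rw [intervalIntegrable_iff_integrableOn_Ioc_of_le hab]
  exact (hv.memLp_deriv_restrict_Ioc ha hab hb).integrable le_top

theorem intervalIntegrable_sub_rpow_neg_smul_deriv (hv : TimeRegular T v) {α t a b : ℝ}
    (hα : α < 1) (ha : 0 < a) (hab : a ≤ b) (hb : b ≤ T) :
    IntervalIntegrable (fun s => (t - s) ^ (-α) • deriv v s) volume a b := by
  have hk : IntervalIntegrable (fun s => (t - s) ^ (-α)) volume a b :=
    intervalIntegrable_sub_rpow_neg hα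
  rw [intervalIntegrable_iff_integrableOn_Ioc_of_le hab] at hk ⊢
  exact memLp_one_iff_integrable.1
    ((hv.memLp_deriv_restrict_Ioc ha hab hb).smul (memLp_one_iff_integrable.2 hk))

theorem continuousOn (hv : TimeRegular T v) : ContinuousOn v (Ioc 0 T) := by
  intro t ht
  have ht2 : t / 2 < t := half_lt_self ht.1
  have h := intervalIntegral.continuousOn_primitive_interval'
    (hv.intervalIntegrable_deriv (half_pos ht.1) (ht2.le.trans ht.2) le_rfl) left_mem_uIcc
  rw [uIcc_of_le (ht2.le.trans ht.2)] at h
  have h' : ContinuousOn v (Icc (t / 2) T) := by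
    refine (h.add_const (v (t / 2))).congr fun x hx => ?_
    have e := hv.integral_deriv (t / 2) x (half_pos ht.1) hx.1 hx.2
    exact (sub_eq_iff_eq_add.1 e.symm)
  refine (h' t ⟨ht2.le, ht.2⟩).mono_of_mem_nhdsWithin ?_
  filter_upwards [self_mem_nhdsWithin, mem_nhdsWithin_of_mem_nhds (Ioi_mem_nhds ht2)] with s hs hs'
  exact ⟨(mem_Ioi.1 hs').le, hs.2⟩

/-- The essential bound holds at every point by continuity: a violation at `t` would persist on a
left neighbourhood of `t`, which has positive measure. -/
theorem exists_norm_le (hv : TimeRegular T v) : ∃ M, ∀ t ∈ Ioc 0 T, ‖v t‖ ≤ M := by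
  rcases le_or_gt T 0 with hT | hT
  · exact ⟨0, fun t ht => absurd (ht.1.trans_le ht.2) hT.not_gt⟩
  have hmem := hv.memLp T hT le_rfl
  refine ⟨lpNorm v ∞ (volume.restrict (Ioo 0 T)), fun t ht => ?_⟩
  by_contra! hlt
  have hae : ∀ᵐ s, s ∈ Ioo 0 T → ‖v s‖ ≤ lpNorm v ∞ (volume.restrict (Ioo 0 T)) :=
    (ae_restrict_iff' measurableSet_Ioo).1 (ae_le_lpNorm_exponent_top hmem)
  have hnear : ∀ᶠ s in 𝓝[Iio t] t, lpNorm v ∞ (volume.restrict (Ioo 0 T)) < ‖v s‖ := by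
    have h1 := (hv.continuousOn t ht).norm.eventually (lt_mem_nhds hlt)
    refine h1.filter_mono ?_
    rw [← nhdsWithin_Ioo_eq_nhdsLT ht.1]
    exact nhdsWithin_mono _ fun s hs => ⟨hs.1, hs.2.le.trans ht.2⟩
  obtain ⟨a, ha, hsub⟩ := (mem_nhdsLT_iff_exists_Ioo_subset' (a := t) ht.1).1
    (inter_mem hnear (Ioo_mem_nhdsLT ht.1))
  have hnull : volume (Ioo a t) = 0 := by
    refine measure_mono_null (fun s hs => ?_) hae
    have h := hsub hs
    simp only [mem_compl_iff, mem_ofPred_eq, Classical.not_imp, not_le]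
    exact ⟨⟨h.2.1, h.2.2.trans_le ht.2⟩, h.1⟩
  rw [Real.volume_Ioo, ENNReal.ofReal_eq_zero] at hnull
  linarith [mem_Iio.1 ha]

variable [CompleteSpace X]

theorem integral_apply_deriv (hv : TimeRegular T v) (l : X →L[ℝ] ℝ) {a b : ℝ} (ha : 0 < a)
    (hab : a ≤ b) (hb : b ≤ T) : ∫ s in a..b, l (deriv v s) = l (v b) - l (v a) := by
  rw [l.intervalIntegral_comp_comm (hv.intervalIntegrable_deriv ha hab hb),
    hv.integral_deriv a b ha hab hb, map_sub]

theorem apply_integral_smul_deriv (hv : TimeRegular T v) (l : X →L[ℝ] ℝ) {α t a b : ℝ}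
    (hα : α < 1) (ha : 0 < a) (hab : a ≤ b) (hb : b ≤ T) :
    l (∫ s in a..b, (t - s) ^ (-α) • deriv v s) = ∫ s in a..b, (t - s) ^ (-α) * l (deriv v s) := by
  rw [← l.intervalIntegral_comp_comm
    (hv.intervalIntegrable_sub_rpow_neg_smul_deriv hα ha hab hb)]
  simp

/-- A norming functional reduces this to the scalar estimate. The bound involves `v` but not its
derivative, which may blow up at time `0`, and it tends to `0` with `b`; this gives the Cauchy
property of the truncations. -/
theorem norm_caputo_increment_le (hv : TimeRegular T v) {α t a b M : ℝ} (hα : α ∈ Ioo (0 : ℝ) 1)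
    (ht : t ≤ T) (ha : 0 < a) (hab : a ≤ b) (hb : b < t) (hM : ∀ s ∈ Ioc 0 T, ‖v s‖ ≤ M) :
    ‖t ^ (-α) • (v a - v b) + ∫ s in a..b, (t - s) ^ (-α) • deriv v s‖
      ≤ 2 * M * ((t - b) ^ (-α) - t ^ (-α)) := by
  obtain ⟨l, hl, hlx⟩ := exists_dual_vector'' ℝ
    (t ^ (-α) • (v a - v b) + ∫ s in a..b, (t - s) ^ (-α) • deriv v s)
  have hbT : b ≤ T := hb.le.trans ht
  rw [map_add, hv.apply_integral_smul_deriv l hα.2 ha hab hbT, map_smul, map_sub, smul_eq_mul]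
    at hlx
  have h := abs_caputo_increment_le (z := fun s => l (v s)) (M := M) hα.1 ha hab hb
    ⟨l.integrable_comp (hv.intervalIntegrable_deriv ha hab hbT).1,
      l.integrable_comp (hv.intervalIntegrable_deriv ha hab hbT).2⟩
    (fun x hx => hv.integral_apply_deriv l ha hx.1 (hx.2.trans hbT))
    (fun x hx => (l.le_opNorm _).trans ((mul_le_of_le_one_left (norm_nonneg _) hl).trans
      (hM x ⟨ha.trans_le hx.1, hx.2.trans hbT⟩)))
  rw [hlx] at h
  exact (le_abs_self _).trans h

/-- The Caputo derivative of a function of class `L_∞(0, T) ∩ W^{1,∞}(ε, T)` exists. -/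
theorem tendsto_caputoTrunc (hv : TimeRegular T v) {α t : ℝ} (hα : α ∈ Ioo (0 : ℝ) 1)
    (ht : t ∈ Ioc 0 T) :
    Tendsto (caputoTrunc α v t) (𝓝[>] 0) (𝓝 (caputoDeriv α v t)) := by
  obtain ⟨M, hM⟩ := hv.exists_norm_le
  refine tendsto_nhds_limUnder ?_
  rw [← cauchy_map_iff_exists_tendsto, Metric.cauchy_iff]
  refine ⟨inferInstance, fun η hη => ?_⟩
  have hΓ : 0 < (Real.Gamma (1 - α))⁻¹ :=
    inv_pos.2 (Real.Gamma_pos_of_pos (by linarith [hα.2]))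
  have hlim : Tendsto
      (fun r => (Real.Gamma (1 - α))⁻¹ * (2 * M * ((t - r) ^ (-α) - t ^ (-α)))) (𝓝[>] 0) (𝓝 0) := by
    have h : ContinuousAt (fun r => (t - r) ^ (-α)) 0 :=
      (hasDerivAt_sub_rpow_neg (s := 0) ht.1).continuousAt
    have h1 := ((h.tendsto.sub_const (t ^ (-α))).const_mul (2 * M)).const_mul
      (Real.Gamma (1 - α))⁻¹
    simp only [sub_zero, sub_self, mul_zero] at h1
    exact h1.mono_left nhdsWithin_le_nhds
  have hev := (hlim.eventually (gt_mem_nhds hη)).and (Ioo_mem_nhdsGT ht.1)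
  have hstep : ∀ a b, a ∈ Ioo 0 t → b ∈ Ioo 0 t → a ≤ b →
      (Real.Gamma (1 - α))⁻¹ * (2 * M * ((t - b) ^ (-α) - t ^ (-α))) < η →
      dist (caputoTrunc α v t a) (caputoTrunc α v t b) < η := by
    intro a b ha hb hab hlt
    refine lt_of_le_of_lt ?_ hlt
    have hint : ∀ x y, 0 < x → x ≤ y → y ≤ t →
        IntervalIntegrable (fun s => (t - s) ^ (-α) • deriv v s) volume x y := fun x y hx hxy hy =>
      hv.intervalIntegrable_sub_rpow_neg_smul_deriv hα.2 hx hxy (hy.trans ht.2)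
    have e : caputoTrunc α v t a - caputoTrunc α v t b = (Real.Gamma (1 - α))⁻¹ •
        (t ^ (-α) • (v a - v b) + ∫ s in a..b, (t - s) ^ (-α) • deriv v s) := by
      rw [caputoTrunc, caputoTrunc, ← smul_sub,
        ← intervalIntegral.integral_add_adjacent_intervals (hint a b ha.1 hab hb.2.le)
          (hint b t hb.1 hb.2.le le_rfl)]
      congr 1
      module
    rw [dist_eq_norm, e, norm_smul, Real.norm_of_nonneg hΓ.le]
    exact mul_le_mul_of_nonneg_left (hv.norm_caputo_increment_le hα ht.2 ha.1 hab hb.2 hM) hΓ.le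
  refine ⟨_, image_mem_map hev, ?_⟩
  rintro _ ⟨a, ⟨ha, ha'⟩, rfl⟩ _ ⟨b, ⟨hb, hb'⟩, rfl⟩
  rcases le_total a b with hab | hab
  · exact hstep a b ha' hb' hab hb
  · rw [dist_comm]
    exact hstep b a hb' ha' hab ha

end TimeRegular

end TimeRegular

/-! ### The touching argument and the comparison principle. -/

section Comparison

/-- A bounded continuous function on `(0, T]` that is positive somewhere is touched from above by
a multiple of any positive continuous function that blows up at time `0`. -/
theorem exists_touching_multiple {T M : ℝ} {F B : ℝ → ℝ} (hF : ContinuousOn F (Ioc 0 T))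
    (hFM : ∀ t ∈ Ioc 0 T, F t ≤ M) (hB : ContinuousOn B (Ioc 0 T))
    (hBpos : ∀ t ∈ Ioc 0 T, 0 < B t) (hBtop : Tendsto B (𝓝[>] 0) atTop)
    {t₁ : ℝ} (ht₁ : t₁ ∈ Ioc 0 T) (hFt₁ : 0 < F t₁) :
    ∃ t₀ ∈ Ioc 0 T, ∃ δ > 0, F t₀ = δ * B t₀ ∧ ∀ t ∈ Ioc 0 T, F t ≤ δ * B t := by
  have hρ : 0 < F t₁ / B t₁ := div_pos hFt₁ (hBpos t₁ ht₁)
  -- On `(0, a)` the barrier exceeds `M / ρ` with `ρ = F t₁ / B t₁`, so `F / B` cannot exceed its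
  -- value at `t₁` there, and a maximum over a compact interval is global.
  obtain ⟨a, ha, hsub⟩ := (mem_nhdsGT_iff_exists_Ioo_subset' ht₁.1).1
    (hBtop.eventually_ge_atTop (M / (F t₁ / B t₁)))
  have ha0 : 0 < a := ha
  have hK : Icc (min a t₁) T ⊆ Ioc 0 T := fun t ht =>
    ⟨(lt_min ha0 ht₁.1).trans_le ht.1, ht.2⟩
  obtain ⟨t₀, ht₀, hmax⟩ := isCompact_Icc.exists_isMaxOn ⟨t₁, min_le_right _ _, ht₁.2⟩
    ((hF.mono hK).div (hB.mono hK) fun t ht => (hBpos t (hK ht)).ne')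
  have hmax₁ : F t₁ / B t₁ ≤ F t₀ / B t₀ := hmax ⟨min_le_right _ _, ht₁.2⟩
  have hB₀ := hBpos t₀ (hK ht₀)
  refine ⟨t₀, hK ht₀, F t₀ / B t₀, hρ.trans_le hmax₁, (div_mul_cancel₀ _ hB₀.ne').symm,
    fun t ht => ?_⟩
  have hBt := hBpos t ht
  rcases lt_or_ge t (min a t₁) with h | h
  · have h1 : M / (F t₁ / B t₁) ≤ B t := hsub ⟨ht.1, h.trans_le (min_le_left _ _)⟩
    rw [div_le_iff₀ hρ] at h1
    nlinarith [hFM t ht]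
  · rw [← div_le_iff₀ hBt]
    exact hmax ⟨h, ht.2⟩

variable {X : Type*} [NormedAddCommGroup X] [InnerProductSpace ℝ X] [CompleteSpace X]
  {α T lam : ℝ} {u w : ℝ → X} {E : ℝ → ℝ}

/-- At a point `t` where `E + δ B - l (w - u) ≥ 0` vanishes, the truncated Caputo derivative of
this function is nonpositive. -/
theorem caputoTrunc_le_of_touching (hα : α ∈ Ioo (0 : ℝ) 1) (hu : TimeRegular T u)
    (hw : TimeRegular T w) (hwu : w 0 = u 0) (hE0 : 0 ≤ E 0)
    (hE : ∀ ε ∈ Ioc 0 T, AbsolutelyContinuousOnInterval E ε T) {B B' : ℝ → ℝ}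
    (hB : ∀ s, 0 < s → HasDerivAt B (B' s) s) (hB' : ContinuousOn B' (Ioi 0))
    {δ t ε : ℝ} (l : X →L[ℝ] ℝ) (ht : t ≤ T) (hε : ε ∈ Ioo 0 t)
    (hEint : IntervalIntegrable (fun s => (t - s) ^ (-α) • deriv E s) volume ε t)
    (hnonneg : ∀ s ∈ Ioc 0 t, 0 ≤ E s + δ * B s - l (w s - u s))
    (hzero : E t + δ * B t - l (w t - u t) = 0) :
    Real.Gamma (1 - α) * (caputoTrunc α E t ε - l (caputoTrunc α w t ε - caputoTrunc α u t ε))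
      + δ * (t ^ (-α) * B ε + ∫ s in ε..t, (t - s) ^ (-α) * B' s) ≤ 0 := by
  have hε0 := hε.1
  have hεt := hε.2.le
  have hΓ : Real.Gamma (1 - α) ≠ 0 := (Real.Gamma_pos_of_pos (by linarith [hα.2])).ne'
  have hB'c : ContinuousOn B' (uIcc ε t) := hB'.mono fun s hs => by
    rw [uIcc_of_le hεt] at hs
    exact hε0.trans_le hs.1
  have hk : IntervalIntegrable (fun s => (t - s) ^ (-α)) volume ε t :=
    intervalIntegrable_sub_rpow_neg hα.2
  have hl : ∀ {g : ℝ → X} {a b : ℝ}, IntervalIntegrable g volume a b →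
      IntervalIntegrable (fun s => l (g s)) volume a b := fun hg =>
    ⟨l.integrable_comp hg.1, l.integrable_comp hg.2⟩
  have hEac : ∀ x ∈ Icc ε t, AbsolutelyContinuousOnInterval E ε x := fun x hx =>
    (hE ε ⟨hε0, hεt.trans ht⟩).mono (by
      rw [uIcc_of_le hx.1, uIcc_of_le (hεt.trans ht)]
      exact Icc_subset_Icc_right (hx.2.trans ht))
  have hEd : ∀ x ∈ Icc ε t, IntervalIntegrable (deriv E) volume ε x := fun x hx =>
    (hEac x hx).intervalIntegrable_deriv
  have hBd : ∀ x ∈ Icc ε t, IntervalIntegrable (fun s => δ * B' s) volume ε x := fun x hx =>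
    (hB'c.intervalIntegrable.mono_set (by
      rw [uIcc_of_le hx.1, uIcc_of_le hεt]
      exact Icc_subset_Icc_right hx.2)).const_mul δ
  have hwd : ∀ x ∈ Icc ε t, IntervalIntegrable (fun s => l (deriv w s)) volume ε x := fun x hx =>
    hl (hw.intervalIntegrable_deriv hε0 hx.1 (hx.2.trans ht))
  have hud : ∀ x ∈ Icc ε t, IntervalIntegrable (fun s => l (deriv u s)) volume ε x := fun x hx =>
    hl (hu.intervalIntegrable_deriv hε0 hx.1 (hx.2.trans ht))
  have htm : t ∈ Icc ε t := right_mem_Icc.2 hεt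
  have hprim : ∀ x ∈ Icc ε t,
      ∫ s in ε..x, (deriv E s + δ * B' s - (l (deriv w s) - l (deriv u s)))
        = (E x + δ * B x - l (w x - u x)) - (E ε + δ * B ε - l (w ε - u ε)) := by
    intro x hx
    rw [intervalIntegral.integral_sub ((hEd x hx).add (hBd x hx)) ((hwd x hx).sub (hud x hx)),
      intervalIntegral.integral_add (hEd x hx) (hBd x hx),
      intervalIntegral.integral_sub (hwd x hx) (hud x hx),
      (hEac x hx).integral_deriv_eq_sub,
      hw.integral_apply_deriv l hε0 hx.1 (hx.2.trans ht),
      hu.integral_apply_deriv l hε0 hx.1 (hx.2.trans ht),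
      intervalIntegral.integral_eq_sub_of_hasDerivAt (f := fun s => δ * B s)
        (fun s hs => (hB s (by
          rw [uIcc_of_le hx.1] at hs
          exact hε0.trans_le hs.1)).const_mul δ) (hBd x hx), map_sub, map_sub]
    ring
  have hkE : IntervalIntegrable (fun s => (t - s) ^ (-α) * deriv E s) volume ε t := hEint
  have hkB : IntervalIntegrable (fun s => δ * ((t - s) ^ (-α) * B' s)) volume ε t :=
    (hk.mul_continuousOn hB'c).const_mul δ
  have hkl : ∀ {v : ℝ → X}, TimeRegular T v →
      IntervalIntegrable (fun s => (t - s) ^ (-α) * l (deriv v s)) volume ε t := fun hv => by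
    simpa using hl (hv.intervalIntegrable_sub_rpow_neg_smul_deriv (t := t) hα.2 hε0 hεt ht)
  have hfun : ∀ s, (t - s) ^ (-α) * (deriv E s + δ * B' s - (l (deriv w s) - l (deriv u s)))
      = (t - s) ^ (-α) * deriv E s + δ * ((t - s) ^ (-α) * B' s)
        - ((t - s) ^ (-α) * l (deriv w s) - (t - s) ^ (-α) * l (deriv u s)) := fun s => by ring
  have hkq : IntervalIntegrable (fun s => (t - s) ^ (-α) *
      (deriv E s + δ * B' s - (l (deriv w s) - l (deriv u s)))) volume ε t := by
    simp only [hfun]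
    exact (hkE.add hkB).sub ((hkl hw).sub (hkl hu))
  have key := integral_sub_rpow_neg_mul_le_of_nonneg hα.1 hε.2
    (((hEd t htm).add (hBd t htm)).sub ((hwd t htm).sub (hud t htm))) hkq hprim
    (fun x hx => hnonneg x ⟨hε0.trans_le hx.1, hx.2⟩) hzero
  simp only [hfun] at key
  rw [intervalIntegral.integral_sub (hkE.add hkB) ((hkl hw).sub (hkl hu)),
    intervalIntegral.integral_add hkE hkB, intervalIntegral.integral_sub (hkl hw) (hkl hu),
    intervalIntegral.integral_const_mul] at key
  -- The weight `(t - ε)^(-α)` from integration by parts can be lowered to `t^(-α)`, because the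
  -- touching function is nonnegative at `ε`. The initial value of `B` counts as `0`, and that of
  -- `E` is dropped by its sign.
  have hkε : t ^ (-α) ≤ (t - ε) ^ (-α) := by
    simpa using sub_rpow_neg_le (t := t) hα.1.le hε0.le hε.2
  have ht0 : 0 ≤ t ^ (-α) * E 0 :=
    mul_nonneg (Real.rpow_nonneg (hε0.le.trans hεt) _) hE0
  have hzε := mul_le_mul_of_nonneg_right hkε (hnonneg ε ⟨hε0, hεt⟩)
  have e : Real.Gamma (1 - α) *
      (caputoTrunc α E t ε - l (caputoTrunc α w t ε - caputoTrunc α u t ε))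
      = t ^ (-α) * (E ε - E 0 - (l (w ε) - l (u ε))) + ((∫ s in ε..t, (t - s) ^ (-α) * deriv E s)
        - ((∫ s in ε..t, (t - s) ^ (-α) * l (deriv w s))
          - ∫ s in ε..t, (t - s) ^ (-α) * l (deriv u s))) := by
    simp only [caputoTrunc, map_sub, map_smul, map_add, smul_eq_mul, hwu,
      hw.apply_integral_smul_deriv l (t := t) hα.2 hε0 hεt ht,
      hu.apply_integral_smul_deriv l (t := t) hα.2 hε0 hεt ht]
    field_simp
    ring
  rw [e]
  rw [map_sub] at key hzε
  linarith

/-- A comparison principle for the Caputo derivative: `E` dominates `‖w - u‖` if it does so for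
the differential inequality satisfied by this norm. -/
theorem norm_sub_le_of_inner_caputoDeriv_le (hα : α ∈ Ioo (0 : ℝ) 1) (hT : 0 < T)
    (hu : TimeRegular T u) (hw : TimeRegular T w) (hwu : w 0 = u 0)
    (hE_nonneg : ∀ t ∈ Icc 0 T, 0 ≤ E t)
    (hE : ∀ ε ∈ Ioc 0 T, AbsolutelyContinuousOnInterval E ε T)
    (hE_caputo : ∀ t ∈ Ioc 0 T, ∃ D : ℝ, HasCaputoDeriv α E t D)
    (hle : ∀ t ∈ Ioc 0 T, ⟪w t - u t, caputoDeriv α w t - caputoDeriv α u t⟫_ℝ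
      + lam * ‖w t - u t‖ ^ 2 ≤ (caputoDeriv α E t + lam * E t) * ‖w t - u t‖) :
    ∀ t ∈ Icc 0 T, ‖w t - u t‖ ≤ E t := by
  intro t₁ ht₁
  rcases ht₁.1.eq_or_lt with rfl | ht₁0
  · simpa [hwu] using hE_nonneg 0 ht₁
  by_contra! hlt
  obtain ⟨B, B', hB, hB', hBpos, hBtop, hBsup⟩ := exists_caputo_barrier lam hα hT
  obtain ⟨Mu, hMu⟩ := hu.exists_norm_le
  obtain ⟨Mw, hMw⟩ := hw.exists_norm_le
  have hEc : ContinuousOn E (Ioc 0 T) := by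
    intro t ht
    have h := (hE (t / 2) ⟨half_pos ht.1, (half_lt_self ht.1).le.trans ht.2⟩).continuousOn
    rw [uIcc_of_le ((half_lt_self ht.1).le.trans ht.2)] at h
    refine (h t ⟨(half_lt_self ht.1).le, ht.2⟩).mono_of_mem_nhdsWithin ?_
    filter_upwards [self_mem_nhdsWithin,
      mem_nhdsWithin_of_mem_nhds (Ioi_mem_nhds (half_lt_self ht.1))] with s hs hs'
    exact ⟨(mem_Ioi.1 hs').le, hs.2⟩
  obtain ⟨t, ht, δ, hδ, htouch, hbelow⟩ :=
    exists_touching_multiple (F := fun s => ‖w s - u s‖ - E s) (M := Mw + Mu)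
      ((hw.continuousOn.sub hu.continuousOn).norm.sub hEc)
      (fun s hs => by
        linarith [norm_sub_le (w s) (u s), hMu s hs, hMw s hs, hE_nonneg s ⟨hs.1.le, hs.2⟩])
      (fun s hs => (hB s hs.1).continuousAt.continuousWithinAt) hBpos hBtop ⟨ht₁0, ht₁.2⟩
      (sub_pos.2 hlt)
  have hy : 0 < ‖w t - u t‖ := by
    have := mul_pos hδ (hBpos t ht)
    linarith [hE_nonneg t ⟨ht.1.le, ht.2⟩]
  -- The direction is frozen at time `t`: `l` lies below the norm everywhere, with equality at `w t
  -- - u t`, so the contact at `t` survives the passage from norm to `l`.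
  set l : X →L[ℝ] ℝ := ‖w t - u t‖⁻¹ • innerSL ℝ (w t - u t) with hl
  have hlapp : ∀ x, l x = ‖w t - u t‖⁻¹ * ⟪w t - u t, x⟫_ℝ := fun x => rfl
  have hl_le : ∀ x, l x ≤ ‖x‖ := fun x => by
    rw [hlapp, inv_mul_le_iff₀ hy]
    exact real_inner_le_norm _ _
  have hl_t : l (w t - u t) = ‖w t - u t‖ := by
    rw [hlapp, real_inner_self_eq_norm_sq]
    field_simp
  obtain ⟨D, hD⟩ := hE_caputo t ht
  obtain ⟨c, hc, hcB⟩ := hBsup t ht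
  have hΓ : 0 < Real.Gamma (1 - α) := Real.Gamma_pos_of_pos (by linarith [hα.2])
  have hlim : Tendsto (fun ε => Real.Gamma (1 - α) *
      (caputoTrunc α E t ε - l (caputoTrunc α w t ε - caputoTrunc α u t ε))) (𝓝[>] 0)
      (𝓝 (Real.Gamma (1 - α) * (D - l (caputoDeriv α w t - caputoDeriv α u t)))) :=
    (hD.2.sub ((l.continuous.tendsto _).comp
      ((hw.tendsto_caputoTrunc hα ht).sub (hu.tendsto_caputoTrunc hα ht)))).const_mul _
  -- Only a lower bound, valid for all small `ε`, is used for the barrier; its truncations need not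
  -- converge.
  have hbound : Real.Gamma (1 - α) * (D - l (caputoDeriv α w t - caputoDeriv α u t))
      ≤ δ * (Real.Gamma (1 - α) * lam * B t - c) := by
    refine le_of_tendsto hlim ?_
    filter_upwards [hcB, Ioo_mem_nhdsGT ht.1] with ε hε hεt
    have h := caputoTrunc_le_of_touching hα hu hw hwu (hE_nonneg 0 ⟨le_rfl, hT.le⟩) hE hB hB'
      (δ := δ) l ht.2 hεt (hD.1 ε hεt)
      (fun s hs => by linarith [hbelow s ⟨hs.1, hs.2.trans ht.2⟩, hl_le (w s - u s)])
      (by rw [hl_t]; linarith)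
    nlinarith
  have hineq := hle t ht
  rw [hD.caputoDeriv_eq] at hineq
  have h1 : l (caputoDeriv α w t - caputoDeriv α u t) ≤ D + lam * E t - lam * ‖w t - u t‖ := by
    rw [hlapp, inv_mul_le_iff₀ hy]
    linarith
  -- By contact, the `lam` terms in `h1` equal `-lam * δ * B t`. They cancel against `hbound`, which
  -- leaves `0 ≤ -δ * c`.
  have h2 : lam * (‖w t - u t‖ - E t) = lam * (δ * B t) := by rw [htouch]
  have h3 := mul_le_mul_of_nonneg_left
    (show lam * (δ * B t) ≤ D - l (caputoDeriv α w t - caputoDeriv α u t) by linarith) hΓ.le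
  nlinarith [mul_pos hδ hc]

end Comparison

/-! ### Application to the weak formulation. -/

/-- Subtracting the two equations eliminates `f`. Testing with the difference, which lies in `H01
Ω`, and using coercivity and Cauchy-Schwarz gives the scalar inequality required by the comparison
principle. -/
theorem corollary1 {d : ℕ} (Ω : Set (EuclideanSpace ℝ (Fin d))) (hΩ : IsOpen Ω)
    (α T lam : ℝ) (hα : α ∈ Ioo (0 : ℝ) 1) (hT : 0 < T)
    (L : H01 Ω →L[ℝ] Hneg1 Ω)
    (hL : ∀ v : H01 Ω, lam * ‖H01.toL2 Ω v‖ ^ 2 ≤ L v v)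
    (f : ℝ → Hneg1 Ω) (u₀ : L2 Ω) (u uh R : ℝ → L2 Ω)
    (hu_reg : TimeRegular T u) (huh_reg : TimeRegular T uh)
    (hu : IsSolution α T L f u₀ u)
    (huh_zero : uh 0 = u₀) (hR : IsResidual α T L f uh R)
    (E : ℝ → ℝ) (hE_nonneg : ∀ t ∈ Icc 0 T, 0 ≤ E t)
    (hE_ac : ∀ ε ∈ Ioc 0 T, AbsolutelyContinuousOnInterval E ε T)
    (hE_caputo : ∀ t ∈ Ioc 0 T, ∃ D : ℝ, HasCaputoDeriv α E t D)
    (hRE : ∀ t ∈ Ioc 0 T, ‖R t‖ ≤ caputoDeriv α E t + lam * E t) :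
    ∀ t ∈ Icc 0 T, ‖uh t - u t‖ ≤ E t := by
  refine norm_sub_le_of_inner_caputoDeriv_le (lam := lam) hα hT hu_reg huh_reg
    (huh_zero.trans hu.1.symm) hE_nonneg hE_ac hE_caputo fun t ht => ?_
  obtain ⟨U, hU, hUeq⟩ := hu.2 t ht
  obtain ⟨W, hW, hWeq⟩ := hR t ht
  have hV : H01.toL2 Ω (W - U) = uh t - u t := by rw [map_sub, hW, hU]
  have happ : ∀ v : L2 Ω, L2.toHneg1 v (W - U) = ⟪v, uh t - u t⟫_ℝ := fun v => by
    rw [← hV]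
    rfl
  have h1 := congrArg (fun φ : Hneg1 Ω => φ (W - U)) hUeq
  have h2 := congrArg (fun φ : Hneg1 Ω => φ (W - U)) hWeq
  simp only [add_apply, sub_apply, happ] at h1 h2
  have h3 : L (W - U) (W - U) = L W (W - U) - L U (W - U) := by
    rw [map_sub L, sub_apply]
  have h4 := hL (W - U)
  rw [hV, h3] at h4
  have h5 : ⟪R t, uh t - u t⟫_ℝ ≤ (caputoDeriv α E t + lam * E t) * ‖uh t - u t‖ :=
    (real_inner_le_norm _ _).trans (mul_le_mul_of_nonneg_right (hRE t ht) (norm_nonneg _))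
  rw [real_inner_comm, inner_sub_left]
  linarith
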